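/- Let $d\in\mathbb N$ and let $\mathbb M_d$ be the algebra of complex $d\times d$ matrices. A linear map $\psi:\mathbb M_d\to\mathbb M_d$ is called *completely positive* if $\psi\otimes\mathrm{Id}_{\mathbb M_k}$ maps positive semidefinite matrices to positive semidefinite matrices for every $k\in\mathbb N$, and *bcp* (bistochastic completely positive) if it is completely positive, unital ($\psi(\mathbb I)=\mathbb I$) and trace preserving. It is called *strictly positive* if $\psi(p)$ is positive semidefinite of full rank for every nonzero positive semidefinite $p\in\mathbb M_d$. It is called *entanglement breaking* if for every $k\in\mathbb N$ and every positive semidefinite $\rho\in\mathbb M_d\otimes\mathbb M_k$, the matrix $(\psi\otimes\mathrm{Id}_{\mathbb M_k})(\rho)$ lies in the convex cone generated by the matrices $P\otimes Q$ with $P\in\mathbb M_d$ and $Q\in\mathbb M_k$ positive semidefinite. Let $(\Omega,\mathcal F,\mu)$ be a probability space (for instance a standard one), let $T:\Omega\to\Omega$ be an invertible (with measurable inverse) ergodic measure-preserving transformation, and let $\phi$ be a measurable map from $\Omega$ to the set of bcp maps on $\mathbb M_d$ (with its Borel $\sigma$-algebra). For $n\ge 1$ and $\omega\in\Omega$ put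 $$\Phi^{(n)}_\omega=\phi_{T^{n-1}(\omega)}\circ\cdots\circ\phi_{T(\omega)}\circ\phi_\omega .$$ Suppose that for almost every $\omega\in\Omega$ there is $N_0\in\mathbb N$ such that $\Phi^{(n)}_\omega$ is strictly positive for all $n\ge N_0$. Then for almost every $\omega\in\Omega$ there is $n\ge 1$ such that $\Phi^{(n)}_\omega$ is entanglement breaking; moreover, for almost every $\omega\in\Omega$ there is $N\in\mathbb N$ such that $\Phi^{(n)}_\omega$ is entanglement breaking for all $n\ge N$. -/

import Mathlib

open scoped ComplexOrder Kronecker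
open MeasureTheory

/-- The algebra of `d × d` complex matrices. -/
abbrev Mat (d : ℕ) : Type := Matrix (Fin d) (Fin d) ℂ

/-- Linear maps `M_d → M_d` (continuity is automatic in finite dimension), with the topology
of Mathlib on continuous linear maps, which is that of every operator norm. -/
abbrev Superop (d : ℕ) : Type := Mat d →L[ℂ] Mat d

/-- The Borel `σ`-algebra of the operator norm topology. -/
noncomputable instance Superop.instMeasurableSpace (d : ℕ) : MeasurableSpace (Superop d) := borel (Superop d)

instance Superop.instBorelSpace (d : ℕ) : BorelSpace (Superop d) := ⟨rfl⟩

/-- `ψ ⊗ Id` on `M_d ⊗ M_k`, where `M_d ⊗ M_k` is identified with the matrices indexed by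
`Fin d × Fin k` through the Kronecker product. -/
noncomputable def Superop.ampliation {d : ℕ} (ψ : Superop d) (k : ℕ) :
    Matrix (Fin d × Fin k) (Fin d × Fin k) ℂ →ₗ[ℂ] Matrix (Fin d × Fin k) (Fin d × Fin k) ℂ where
  toFun ρ := Matrix.of fun x y => ψ (Matrix.of fun i j => ρ (i, x.2) (j, y.2)) x.1 y.1
  map_add' ρ σ := by
    ext x y
    exact congrFun (congrFun (ψ.map_add (Matrix.of fun i j => ρ (i, x.2) (j, y.2))
      (Matrix.of fun i j => σ (i, x.2) (j, y.2))) x.1) y.1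
  map_smul' c ρ := by
    ext x y
    exact congrFun (congrFun (ψ.map_smul c (Matrix.of fun i j => ρ (i, x.2) (j, y.2))) x.1) y.1

/-- The ampliation is the map determined by `a ⊗ b ↦ ψ(a) ⊗ b`. -/
theorem Superop.ampliation_kronecker {d : ℕ} (ψ : Superop d) (k : ℕ) (a : Mat d) (b : Mat k) :
    ψ.ampliation k (a ⊗ₖ b) = ψ a ⊗ₖ b := by
  ext x y
  have h : (Matrix.of fun i j => (a ⊗ₖ b) (i, x.2) (j, y.2)) = b x.2 y.2 • a := by
    ext i j
    simp [mul_comm]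
  simp only [Superop.ampliation, LinearMap.coe_mk, AddHom.coe_mk, Matrix.of_apply]
  rw [h, map_smul]
  simp [mul_comm]

/-- `ψ` is completely positive: every `ψ ⊗ Id_{M_k}` preserves positive semidefiniteness. -/
def Superop.IsCP {d : ℕ} (ψ : Superop d) : Prop :=
  ∀ (k : ℕ) (ρ : Matrix (Fin d × Fin k) (Fin d × Fin k) ℂ),
    ρ.PosSemidef → (ψ.ampliation k ρ).PosSemidef

/-- Bistochastic completely positive maps: completely positive, unital, trace preserving. -/
structure Superop.IsBCP {d : ℕ} (ψ : Superop d) : Prop where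
  cp : ψ.IsCP
  unital : ψ 1 = 1
  trace_preserving : ∀ a : Mat d, (ψ a).trace = a.trace

/-- The set of bcp maps. -/
def bcp (d : ℕ) : Set (Superop d) := {ψ | ψ.IsBCP}

/-- The convex cone in `M_d ⊗ M_k` generated by the `P ⊗ Q` with `P`, `Q` positive
semidefinite. -/
noncomputable def separableCone (d k : ℕ) : PointedCone ℝ (Matrix (Fin d × Fin k) (Fin d × Fin k) ℂ) :=
  PointedCone.hull ℝ
    {M | ∃ (P : Mat d) (Q : Mat k), P.PosSemidef ∧ Q.PosSemidef ∧ M = P ⊗ₖ Q}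

/-- `ψ` is entanglement breaking. -/
def Superop.IsEB {d : ℕ} (ψ : Superop d) : Prop :=
  ∀ (k : ℕ) (ρ : Matrix (Fin d × Fin k) (Fin d × Fin k) ℂ),
    ρ.PosSemidef → ψ.ampliation k ρ ∈ separableCone d k

/-- `ψ` is strictly positive: it maps every nonzero positive semidefinite matrix to a positive
semidefinite matrix of full rank. -/
def Superop.IsStrictlyPositive {d : ℕ} (ψ : Superop d) : Prop :=
  ∀ p : Mat d, p.PosSemidef → p ≠ 0 → (ψ p).PosSemidef ∧ (ψ p).rank = d

/-- The cocycle `Φ⁽ⁿ⁾_ω = φ_{T^{n-1} ω} ∘ ⋯ ∘ φ_{T ω} ∘ φ_ω`, with `Φ⁽⁰⁾_ω = Id`. -/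
noncomputable def cocycle {Ω : Type*} {d : ℕ} (T : Ω → Ω) (φ : Ω → bcp d) : ℕ → Ω → Superop d
  | 0, _ => ContinuousLinearMap.id ℂ (Mat d)
  | n + 1, ω => (φ (T^[n] ω) : Superop d).comp (cocycle T φ n ω)

/-- Almost surely, `Φ⁽ⁿ⁾_ω` is strictly positive for all large `n`. -/
def EventuallyStrictlyPositive {Ω : Type*} [MeasurableSpace Ω] (μ : Measure Ω) {d : ℕ}
    (T : Ω → Ω) (φ : Ω → bcp d) : Prop :=
  ∀ᵐ ω ∂μ, ∃ N₀ : ℕ, ∀ n ≥ N₀, (cocycle T φ n ω).IsStrictlyPositive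

/-- Almost surely, some `Φ⁽ⁿ⁾_ω` with `n ≥ 1` is entanglement breaking. -/
def EventuallyEB {Ω : Type*} [MeasurableSpace Ω] (μ : Measure Ω) {d : ℕ}
    (T : Ω → Ω) (φ : Ω → bcp d) : Prop :=
  ∀ᵐ ω ∂μ, ∃ n : ℕ, 1 ≤ n ∧ (cocycle T φ n ω).IsEB

/-! Let D be the completely depolarizing map; `r`-mixing says that ψ - (1 - r)D is a positive map.
Bcp maps fix D from both sides, so (ψ - (1 - r)D)(χ - (1 - s)D) = ψχ - (1 - rs)D and defects
multiply (`IsMixing.comp`); every bcp map has defect 1, so further factors never hurt.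

By compactness, a strictly positive bcp map has defect below 1. Hence some block length n₀ and some
r < 1 give an `r`-mixing block on a set of positive measure. Almost every orbit returns there
infinitely often, and disjoint good blocks push the defect of the cocycle below every r ^ k.

Finally, D lies well inside the entanglement breaking maps: if 4d³r ≤ 1, then ψ is D plus a
deviation small enough to be absorbed into D, leaving a sum of measure-and-prepare maps
(`IsMixing.isEB`). -/

/-! ### Mixing defects of bcp maps -/

/-- A positive map `ψ` is `r`-mixing if `ψ p` dominates `(1 - r)` times the image `tr(p)/d · 1` of
`p` under the completely depolarizing map, for every positive semidefinite `p`. -/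
def Superop.IsMixing {d : ℕ} (r : ℝ) (ψ : Superop d) : Prop :=
  ∀ p : Mat d, p.PosSemidef →
    (ψ p - ((((1 - r) / d : ℝ) : ℂ) * p.trace) • (1 : Mat d)).PosSemidef

theorem Superop.IsCP.map_posSemidef {d : ℕ} {ψ : Superop d} (hψ : ψ.IsCP) {p : Mat d}
    (hp : p.PosSemidef) : (ψ p).PosSemidef := by
  have h := hψ 1 (p ⊗ₖ (1 : Mat 1)) (hp.kronecker .one)
  rw [Superop.ampliation_kronecker] at h
  convert h.submatrix (fun i => (i, (0 : Fin 1))) using 1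
  ext i j
  simp

theorem Superop.isBCP_id (d : ℕ) : Superop.IsBCP (ContinuousLinearMap.id ℂ (Mat d)) where
  cp k ρ hρ := by
    convert hρ using 1
    rfl
  unital := rfl
  trace_preserving _ := rfl

theorem Superop.IsBCP.comp {d : ℕ} {ψ χ : Superop d} (hψ : ψ.IsBCP) (hχ : χ.IsBCP) :
    Superop.IsBCP (ψ.comp χ) where
  cp k ρ hρ := by
    convert hψ.cp k _ (hχ.cp k ρ hρ) using 1
    rfl
  unital := by simp [hψ.unital, hχ.unital]
  trace_preserving a := by simp [hψ.trace_preserving, hχ.trace_preserving]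

theorem Superop.IsBCP.isMixing_one {d : ℕ} {ψ : Superop d} (hψ : ψ.IsBCP) : ψ.IsMixing 1 := by
  intro p hp
  simpa using hψ.cp.map_posSemidef hp

theorem Superop.IsMixing.mono {d : ℕ} {ψ : Superop d} {r s : ℝ} (h : ψ.IsMixing r) (hrs : r ≤ s) :
    ψ.IsMixing s := by
  intro p hp
  have h₁ : (0 : ℂ) ≤ (((s - r) / d : ℝ) : ℂ) * p.trace := by
    refine mul_nonneg ?_ hp.trace_nonneg
    exact_mod_cast div_nonneg (by linarith) (Nat.cast_nonneg d)
  convert (h p hp).add (Matrix.PosSemidef.one.smul h₁) using 1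
  rw [sub_add, ← sub_smul]
  congr 2
  push_cast
  ring

/-- The mixing defects of bistochastic maps multiply under composition. -/
theorem Superop.IsMixing.comp {d : ℕ} [NeZero d] {ψ χ : Superop d} {r s : ℝ}
    (hψ : ψ.IsMixing r) (hχ : χ.IsMixing s) (bψ : ψ.IsBCP) (bχ : χ.IsBCP) :
    Superop.IsMixing (r * s) (ψ.comp χ) := by
  intro p hp
  have hd : (d : ℂ) ≠ 0 := Nat.cast_ne_zero.2 (NeZero.ne d)
  -- Apply ψ - (1 - r)D to the positive matrix (χ - (1 - s)D) p; the rest is the expansion of the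
  -- product.
  convert hψ _ (hχ p hp) using 1
  simp only [ContinuousLinearMap.comp_apply, map_sub, map_smul, bψ.unital, Matrix.trace_sub,
    Matrix.trace_smul, bχ.trace_preserving, Matrix.trace_one, Fintype.card_fin, smul_eq_mul]
  rw [sub_sub, ← add_smul]
  congr 2
  push_cast
  field_simp
  ring

/-! ### Strict positivity gives a defect below 1 -/

/-- The quadratic form of the image of a rank one matrix. -/
noncomputable def Superop.rankOneForm {d : ℕ} (ψ : Superop d) (u v : Fin d → ℂ) : ℂ :=
  star v ⬝ᵥ (ψ (Matrix.vecMulVec (star u) u)).mulVec v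

theorem Superop.rankOneForm_smul {d : ℕ} (ψ : Superop d) (a b : ℝ) (u v : Fin d → ℂ) :
    ψ.rankOneForm ((a : ℂ) • u) ((b : ℂ) • v) = ((a ^ 2 * b ^ 2 : ℝ) : ℂ) * ψ.rankOneForm u v := by
  unfold Superop.rankOneForm
  simp only [star_smul, Matrix.smul_vecMulVec, Matrix.vecMulVec_smul, map_smul,
    Matrix.smul_mulVec, Matrix.mulVec_smul, dotProduct_smul, smul_dotProduct, smul_eq_mul]
  simp
  ring

theorem Superop.IsStrictlyPositive.rankOneForm_pos {d : ℕ} {ψ : Superop d}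
    (hψ : ψ.IsStrictlyPositive) {u v : Fin d → ℂ} (hu : u ≠ 0) (hv : v ≠ 0) :
    0 < ψ.rankOneForm u v := by
  obtain ⟨h₁, h₂⟩ := hψ _ (Matrix.posSemidef_vecMulVec_star_self u)
    (Matrix.vecMulVec_ne_zero (star_ne_zero.2 hu) hu)
  have h₃ : IsUnit (ψ (Matrix.vecMulVec (star u) u)) := by
    rw [Matrix.isUnit_iff_isUnit_det, isUnit_iff_ne_zero]
    intro h₀
    obtain ⟨w, hw, hw₀⟩ := Matrix.exists_mulVec_eq_zero_iff.2 h₀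
    have h₄ := LinearMap.finrank_range_add_finrank_ker
      (Matrix.mulVecLin (ψ (Matrix.vecMulVec (star u) u)))
    have h₅ : Module.finrank ℂ (LinearMap.range (Matrix.mulVecLin
      (ψ (Matrix.vecMulVec (star u) u)))) = d := h₂
    rw [h₅, Module.finrank_fin_fun, Nat.add_eq_left, Submodule.finrank_eq_zero] at h₄
    have h₆ : w ∈ LinearMap.ker (Matrix.mulVecLin (ψ (Matrix.vecMulVec (star u) u))) := hw₀
    rw [h₄, Submodule.mem_bot] at h₆
    exact hw h₆
  exact (h₁.posDef_iff_isUnit.2 h₃).dotProduct_mulVec_pos hv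

theorem Superop.continuous_rankOneForm {d : ℕ} (ψ : Superop d) :
    Continuous fun x : (Fin d → ℂ) × (Fin d → ℂ) => ψ.rankOneForm x.1 x.2 := by
  unfold Superop.rankOneForm
  have h : Continuous fun x : (Fin d → ℂ) × (Fin d → ℂ) => ψ (Matrix.vecMulVec (star x.1) x.1) :=
    ψ.continuous.comp (continuous_fst.star.matrix_vecMulVec continuous_fst)
  exact continuous_snd.star.dotProduct (h.matrix_mulVec continuous_snd)

theorem dotProduct_star_self_le_norm_sq {d : ℕ} (u : Fin d → ℂ) :
    (star u ⬝ᵥ u).re ≤ d * ‖u‖ ^ 2 := by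
  simp only [dotProduct, Complex.re_sum]
  calc ∑ i, (star u i * u i).re ≤ ∑ _i : Fin d, ‖u‖ ^ 2 := by
        refine Finset.sum_le_sum fun i _ => ?_
        have h : (star u i * u i).re = ‖u i‖ ^ 2 := by
          rw [Pi.star_apply, Complex.star_def, Complex.conj_mul']
          exact_mod_cast rfl
        rw [h]
        gcongr
        exact norm_le_pi_norm u i
    _ = d * ‖u‖ ^ 2 := by simp

/-- By compactness, the quadratic forms of a strictly positive map are uniformly positive on rank
one matrices. -/
theorem Superop.IsStrictlyPositive.exists_rankOneForm_ge {d : ℕ} [NeZero d] {ψ : Superop d}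
    (hψ : ψ.IsStrictlyPositive) : ∃ m : ℝ, 0 < m ∧ ∀ u v : Fin d → ℂ,
      m * (star u ⬝ᵥ u).re * (star v ⬝ᵥ v).re ≤ (ψ.rankOneForm u v).re := by
  have hd : (0 : ℝ) < d := Nat.cast_pos.2 (NeZero.pos d)
  let K := Metric.sphere (0 : Fin d → ℂ) 1 ×ˢ Metric.sphere (0 : Fin d → ℂ) 1
  have hK : IsCompact K := (isCompact_sphere _ _).prod (isCompact_sphere _ _)
  have hne : K.Nonempty :=
    (NormedSpace.sphere_nonempty.2 zero_le_one).prod (NormedSpace.sphere_nonempty.2 zero_le_one)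
  obtain ⟨x, hx, hmin⟩ := hK.exists_isMinOn hne
    (Complex.continuous_re.comp ψ.continuous_rankOneForm).continuousOn
  have hx₁ : x.1 ≠ 0 := ne_zero_of_mem_unit_sphere (⟨x.1, hx.1⟩ : Metric.sphere _ _)
  have hx₂ : x.2 ≠ 0 := ne_zero_of_mem_unit_sphere (⟨x.2, hx.2⟩ : Metric.sphere _ _)
  set M := (ψ.rankOneForm x.1 x.2).re with hM
  have hM₀ : 0 < M := (Complex.pos_iff.1 (hψ.rankOneForm_pos hx₁ hx₂)).1
  have key : ∀ u v : Fin d → ℂ, M * ‖u‖ ^ 2 * ‖v‖ ^ 2 ≤ (ψ.rankOneForm u v).re := by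
    intro u v
    rcases eq_or_ne u 0 with rfl | hu
    · simp [Superop.rankOneForm]
    rcases eq_or_ne v 0 with rfl | hv
    · simp [Superop.rankOneForm]
    have hu' : ‖u‖ ≠ 0 := norm_ne_zero_iff.2 hu
    have hv' : ‖v‖ ≠ 0 := norm_ne_zero_iff.2 hv
    have h₁ := hmin (show (((‖u‖⁻¹ : ℝ) : ℂ) • u, ((‖v‖⁻¹ : ℝ) : ℂ) • v) ∈ K by
      constructor <;> simp [norm_smul, hu', hv'])
    simp only [Function.comp_apply, Set.mem_ofPred_eq] at h₁
    rw [ψ.rankOneForm_smul, Complex.re_ofReal_mul] at h₁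
    calc M * ‖u‖ ^ 2 * ‖v‖ ^ 2
        ≤ (‖u‖⁻¹ ^ 2 * ‖v‖⁻¹ ^ 2 * (ψ.rankOneForm u v).re) * ‖u‖ ^ 2 * ‖v‖ ^ 2 := by gcongr
      _ = _ := by field_simp
  -- The norm here is the sup norm, whose square controls the Euclidean one up to a factor d, once
  -- for each vector.
  refine ⟨M / d ^ 2, by positivity, fun u v => le_trans ?_ (key u v)⟩
  have hu₀ : 0 ≤ (star u ⬝ᵥ u).re := (Complex.nonneg_iff.1 (dotProduct_star_self_nonneg u)).1
  have hv₀ : 0 ≤ (star v ⬝ᵥ v).re := (Complex.nonneg_iff.1 (dotProduct_star_self_nonneg v)).1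
  calc M / d ^ 2 * (star u ⬝ᵥ u).re * (star v ⬝ᵥ v).re
      ≤ M / d ^ 2 * (d * ‖u‖ ^ 2) * (d * ‖v‖ ^ 2) := by
        gcongr
        · exact dotProduct_star_self_le_norm_sq u
        · exact dotProduct_star_self_le_norm_sq v
    _ = M * ‖u‖ ^ 2 * ‖v‖ ^ 2 := by field_simp

/-- The lower bound m on rank one matrices extends to all positive semidefinite ones by
decomposition into a sum; r = 1 - d m makes (1 - r)/d equal to m. -/
theorem Superop.IsStrictlyPositive.exists_isMixing {d : ℕ} [NeZero d] {ψ : Superop d}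
    (hψ : ψ.IsStrictlyPositive) (hb : ψ.IsBCP) : ∃ r : ℝ, r < 1 ∧ ψ.IsMixing r := by
  have hd : (0 : ℝ) < d := Nat.cast_pos.2 (NeZero.pos d)
  obtain ⟨m, hm, h⟩ := hψ.exists_rankOneForm_ge
  refine ⟨1 - d * m, by nlinarith [mul_pos hd hm], fun p hp => ?_⟩
  have hc : (1 - (1 - d * m)) / d = m := by field_simp; ring
  rw [hc]
  have rankOne : ∀ u : Fin d → ℂ, (ψ (Matrix.vecMulVec (star u) u) -
      ((m : ℂ) * (Matrix.vecMulVec (star u) u).trace) • (1 : Mat d)).PosSemidef := by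
    intro u
    have hu : star u ⬝ᵥ u = ((star u ⬝ᵥ u).re : ℂ) :=
      Complex.eq_re_of_ofReal_le (dotProduct_star_self_nonneg u)
    have hpsd := hb.cp.map_posSemidef (Matrix.posSemidef_vecMulVec_star_self u)
    refine .of_dotProduct_mulVec_nonneg (hpsd.1.sub ?_) fun v => ?_
    · rw [Matrix.trace_vecMulVec, hu, Matrix.IsHermitian, Matrix.conjTranspose_smul]
      simp
    · have hv : star v ⬝ᵥ v = ((star v ⬝ᵥ v).re : ℂ) :=
        Complex.eq_re_of_ofReal_le (dotProduct_star_self_nonneg v)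
      have hq : ψ.rankOneForm u v = ((ψ.rankOneForm u v).re : ℂ) :=
        Complex.eq_re_of_ofReal_le (hpsd.dotProduct_mulVec_nonneg v)
      rw [Matrix.sub_mulVec, dotProduct_sub, Matrix.smul_mulVec, Matrix.one_mulVec,
        dotProduct_smul, smul_eq_mul, Matrix.trace_vecMulVec, hu, hv,
        show star v ⬝ᵥ (ψ (Matrix.vecMulVec (star u) u)).mulVec v = ψ.rankOneForm u v from rfl, hq]
      exact_mod_cast sub_nonneg.2 (h u v)
  obtain ⟨n, u, rfl⟩ := Matrix.posSemidef_iff_eq_sum_vecMulVec.1 hp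
  rw [map_sum, Matrix.trace_sum, Finset.mul_sum, Finset.sum_smul, ← Finset.sum_sub_distrib]
  refine Matrix.posSemidef_sum _ fun k _ => ?_
  simpa using rankOne (star (u k))

/-! ### The cone of entanglement breaking maps -/

/-- Entanglement breaking for an arbitrary map `f`, read as `f ⊗ Id` on `M_d ⊗ M_k` for all `k`. -/
def BreaksEntanglement {d : ℕ} (f : Mat d → Mat d) : Prop :=
  ∀ (k : ℕ) (ρ : Matrix (Fin d × Fin k) (Fin d × Fin k) ℂ), ρ.PosSemidef →
    (Matrix.of fun x y => f (Matrix.of fun i j => ρ (i, x.2) (j, y.2)) x.1 y.1) ∈ separableCone d k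

theorem BreaksEntanglement.add {d : ℕ} {f g : Mat d → Mat d} (hf : BreaksEntanglement f)
    (hg : BreaksEntanglement g) : BreaksEntanglement fun a => f a + g a := fun k ρ hρ =>
  add_mem (hf k ρ hρ) (hg k ρ hρ)

theorem BreaksEntanglement.sum {d : ℕ} {ι : Type*} (s : Finset ι) {f : ι → Mat d → Mat d}
    (hf : ∀ i ∈ s, BreaksEntanglement (f i)) : BreaksEntanglement fun a => ∑ i ∈ s, f i a := by
  intro k ρ hρ
  convert sum_mem fun i hi => hf i hi k ρ hρ using 1
  ext x y
  simp [Matrix.sum_apply]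

/-- Slicing the first tensor factor of a positive semidefinite matrix against a positive
semidefinite `F` yields a positive semidefinite matrix. -/
theorem posSemidef_partialTrace {d k : ℕ} {F : Mat d} (hF : F.PosSemidef)
    {ρ : Matrix (Fin d × Fin k) (Fin d × Fin k) ℂ} (hρ : ρ.PosSemidef) :
    (Matrix.of fun x y => (F * Matrix.of fun i j => ρ (i, x) (j, y)).trace).PosSemidef := by
  obtain ⟨n, u, rfl⟩ := Matrix.posSemidef_iff_eq_sum_vecMulVec.1 hF
  -- For F = ∑ u_l u_l*, the slice is ∑ V_l* ρ V_l with V_l = u_l ⊗ 1.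
  have h : (Matrix.of fun x y => ((∑ l, Matrix.vecMulVec (u l) (star (u l))) *
      Matrix.of fun i j => ρ (i, x) (j, y)).trace) =
      ∑ l, (Matrix.of fun (q : Fin d × Fin k) (y : Fin k) =>
          if q.2 = y then u l q.1 else 0).conjTranspose * ρ *
        (Matrix.of fun (q : Fin d × Fin k) (y : Fin k) => if q.2 = y then u l q.1 else 0) := by
    ext x y
    simp only [Matrix.of_apply, Matrix.sum_apply, Finset.sum_mul, Matrix.trace_sum]
    refine Finset.sum_congr rfl fun l _ => ?_
    simp only [Matrix.trace, Matrix.diag, Matrix.mul_apply, Matrix.vecMulVec_apply,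
      Matrix.of_apply, Matrix.conjTranspose_apply, Fintype.sum_prod_type, apply_ite star,
      star_zero, ite_mul, mul_ite, zero_mul, mul_zero, Finset.sum_ite_eq', Finset.mem_univ, if_true,
      Pi.star_apply, Finset.sum_mul]
    refine Finset.sum_congr rfl fun i _ => Finset.sum_congr rfl fun j _ => by ring
  rw [h]
  exact Matrix.posSemidef_sum _ fun l _ => hρ.conjTranspose_mul_mul_same _

/-- Measure-and-prepare maps are entanglement breaking. -/
theorem breaksEntanglement_measure_prepare {d : ℕ} {F P : Mat d} (hF : F.PosSemidef)
    (hP : P.PosSemidef) : BreaksEntanglement fun a => (F * a).trace • P := by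
  intro k ρ hρ
  refine PointedCone.subset_hull ⟨P, _, hP, posSemidef_partialTrace hF hρ, ?_⟩
  ext x y
  simp [mul_comm]

/-! ### A Hermitian frame bounded by 2 -/

/-- The Hermitian matrix `c E_ij + c̄ E_ji`. -/
def hermUnit {d : ℕ} (c : ℂ) (i j : Fin d) : Mat d :=
  Matrix.single i j c + Matrix.single j i (star c)

theorem neg_hermUnit {d : ℕ} (c : ℂ) (i j : Fin d) : -hermUnit c i j = hermUnit (-c) i j := by
  simp only [hermUnit, star_neg, ← Matrix.single_neg]
  abel

theorem posSemidef_two_add_hermUnit {d : ℕ} {c : ℂ} (hc : c * star c = 1) (i j : Fin d) :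
    ((2 : ℂ) • (1 : Mat d) + hermUnit c i j).PosSemidef := by
  have hdiag : ∀ i : Fin d, ((1 : Mat d) - Matrix.single i i 1).PosSemidef := by
    intro i
    rw [← Matrix.diagonal_single, ← Matrix.diagonal_one, Matrix.diagonal_sub]
    refine Matrix.PosSemidef.diagonal fun l => ?_
    rcases eq_or_ne l i with rfl | h <;> simp [*]
  -- With v = c e_i + e_j, the matrix is v v* + (1 - E_ii) + (1 - E_jj), also when i = j.
  convert ((Matrix.posSemidef_vecMulVec_self_star (Pi.single i c + Pi.single j 1)).add
    (hdiag i)).add (hdiag j) using 1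
  have h : Matrix.vecMulVec (Pi.single i c + Pi.single j 1 : Fin d → ℂ)
      (star (Pi.single i c + Pi.single j 1)) =
      Matrix.single i i 1 + Matrix.single j j 1 + hermUnit c i j := by
    rw [star_add, ← Pi.single_star, ← Pi.single_star, Matrix.vecMulVec_add, Matrix.add_vecMulVec,
      Matrix.add_vecMulVec]
    have hs : ∀ (k l : Fin d) (b c : ℂ), Matrix.vecMulVec (Pi.single k b : Fin d → ℂ)
        (Pi.single l c) = Matrix.single k l (b * c) := by
      intro k l b c
      ext m n
      simp only [Matrix.vecMulVec_apply, Matrix.single_apply, Pi.single_apply, eq_comm (a := k),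
        eq_comm (a := l)]
      split_ifs <;> simp_all
    simp only [hs, hc, hermUnit, star_one, one_mul, mul_one]
    abel
  rw [h, two_smul]
  abel

theorem posSemidef_two_sub_hermUnit {d : ℕ} {c : ℂ} (hc : c * star c = 1) (i j : Fin d) :
    ((2 : ℂ) • (1 : Mat d) - hermUnit c i j).PosSemidef := by
  rw [sub_eq_add_neg, neg_hermUnit]
  exact posSemidef_two_add_hermUnit (by simpa using hc) i j

/-- The Hermitian matrices `E_ij + E_ji` and `i (E_ij - E_ji)` form a self-dual frame. -/
theorem sum_trace_smul_hermUnit {d : ℕ} (a : Mat d) :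
    ∑ i, ∑ j, ∑ c : Fin 2, (hermUnit (![1, Complex.I] c) i j * a).trace •
      hermUnit (![1, Complex.I] c) i j = (4 : ℂ) • a := by
  have htr : ∀ (c : ℂ) (i j : Fin d), (hermUnit c i j * a).trace = c * a j i + star c * a i j := by
    intro c i j
    simp [hermUnit, add_mul, Matrix.trace_add, Matrix.trace_single_mul]
  have hI := Complex.I_mul_I
  simp only [htr, Fin.sum_univ_two, Matrix.cons_val_zero, Matrix.cons_val_one]
  have h : ∀ i j : Fin d, (1 * a j i + star 1 * a i j) • hermUnit 1 i j +
      (Complex.I * a j i + star Complex.I * a i j) • hermUnit Complex.I i j =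
      (2 : ℂ) • Matrix.single i j (a i j) + (2 : ℂ) • Matrix.single j i (a j i) := by
    intro i j
    simp only [hermUnit, smul_add, Matrix.smul_single, smul_eq_mul, star_one, Complex.star_def,
      Complex.conj_I]
    rw [add_add_add_comm, ← Matrix.single_add, ← Matrix.single_add]
    congr 2
    · linear_combination (a j i - a i j) * hI
    · linear_combination (a i j - a j i) * hI
  simp only [h, Finset.sum_add_distrib, ← Finset.smul_sum]
  rw [Finset.sum_comm (f := fun i j => Matrix.single j i (a j i)),
    ← Matrix.matrix_eq_sum_single, ← add_smul]
  norm_num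

/-! ### Small defect implies entanglement breaking -/

/-- A mixing map sends a bounded Hermitian matrix close to the multiple of the identity with the
same trace. -/
theorem Superop.IsMixing.posSemidef_deviation {d : ℕ} [NeZero d] {ψ : Superop d} {r : ℝ}
    (hr : 0 ≤ r) (hψ : ψ.IsMixing r) (h1 : ψ 1 = 1) {X : Mat d}
    (h₁ : ((2 : ℂ) • (1 : Mat d) + X).PosSemidef) (h₂ : ((2 : ℂ) • (1 : Mat d) - X).PosSemidef) :
    (((4 * r : ℝ) : ℂ) • (1 : Mat d) + (ψ X - (X.trace / d) • (1 : Mat d))).PosSemidef := by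
  have hd : (d : ℂ) ≠ 0 := Nat.cast_ne_zero.2 (NeZero.ne d)
  have hc : (0 : ℂ) ≤ ((r / d : ℝ) : ℂ) * ((2 : ℂ) • (1 : Mat d) - X).trace := by
    refine mul_nonneg ?_ h₂.trace_nonneg
    exact_mod_cast div_nonneg hr (Nat.cast_nonneg d)
  -- Mixing at 2 + X leaves the error 2r + r tr(X)/d; adding (r/d) tr(2 - X) ≥ 0 turns it into the
  -- constant 4r.
  convert (hψ _ h₁).add (Matrix.PosSemidef.one.smul hc) using 1
  simp only [map_add, map_smul, h1, Matrix.trace_add, Matrix.trace_sub, Matrix.trace_smul,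
    Matrix.trace_one, Fintype.card_fin, smul_eq_mul]
  match_scalars <;> field_simp
  ring

/-- With Δ = ψ X - tr(X)/d, the term equals 1/8 of tr((2 + X)a)(4r + Δ) + tr((2 - X)a)(4r - Δ), in
which every factor comes from a positive matrix. -/
theorem Superop.IsMixing.breaksEntanglement_term {d : ℕ} [NeZero d] {ψ : Superop d} {r : ℝ}
    (hr : 0 ≤ r) (hψ : ψ.IsMixing r) (h1 : ψ 1 = 1) {X : Mat d}
    (h₁ : ((2 : ℂ) • (1 : Mat d) + X).PosSemidef) (h₂ : ((2 : ℂ) • (1 : Mat d) - X).PosSemidef) :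
    BreaksEntanglement fun a => ((2 * r : ℝ) * a.trace : ℂ) • (1 : Mat d) +
      (1 / 4 : ℂ) • (X * a).trace • (ψ X - (X.trace / d) • (1 : Mat d)) := by
  have h₃ := hψ.posSemidef_deviation hr h1 h₁ h₂
  have h₄ := hψ.posSemidef_deviation (X := -X) hr h1 (by rwa [← sub_eq_add_neg])
    (by rwa [sub_neg_eq_add])
  have h8 : (0 : ℂ) ≤ 1 / 8 := by
    rw [Complex.nonneg_iff]
    norm_num
  convert (breaksEntanglement_measure_prepare h₁ (h₃.smul h8)).add
    (breaksEntanglement_measure_prepare h₂ (h₄.smul h8)) using 2 with a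
  simp only [add_mul, sub_mul, smul_mul_assoc, one_mul, Matrix.trace_add, Matrix.trace_sub,
    Matrix.trace_smul, Matrix.trace_neg, map_neg, smul_eq_mul]
  match_scalars <;> ring

/-- A unital map close to the completely depolarizing one is entanglement breaking. -/
theorem Superop.IsMixing.isEB {d : ℕ} [NeZero d] {ψ : Superop d} {r : ℝ} (hr : 0 ≤ r)
    (hψ : ψ.IsMixing r) (h1 : ψ 1 = 1) (hrd : 4 * d ^ 3 * r ≤ 1) : ψ.IsEB := by
  have hd : (d : ℂ) ≠ 0 := Nat.cast_ne_zero.2 (NeZero.ne d)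
  have hd' : (0 : ℝ) < d := Nat.cast_pos.2 (NeZero.pos d)
  have hc : (0 : ℂ) ≤ ((1 / d - 4 * d ^ 2 * r : ℝ) : ℂ) := by
    have : 4 * (d : ℝ) ^ 2 * r ≤ 1 / d := by
      rw [le_div_iff₀ hd']
      linarith
    exact_mod_cast sub_nonneg.2 this
  have hunit : ∀ c : Fin 2, ![1, Complex.I] c * star (![1, Complex.I] c) = 1 := by
    intro c
    fin_cases c <;> simp
  suffices h : BreaksEntanglement ψ from h
  -- The 2d² frame terms use 2r tr(a) each, 4d²r in total; this is taken out of the coefficient 1/d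
  -- of D.
  convert (breaksEntanglement_measure_prepare Matrix.PosSemidef.one
    (Matrix.PosSemidef.one.smul hc)).add
    (BreaksEntanglement.sum Finset.univ fun i _ => BreaksEntanglement.sum Finset.univ fun j _ =>
      BreaksEntanglement.sum Finset.univ fun c _ => hψ.breaksEntanglement_term hr h1
        (posSemidef_two_add_hermUnit (hunit c) i j)
        (posSemidef_two_sub_hermUnit (hunit c) i j)) using 1
  funext a
  have hf := congrArg (fun x => (1 / 4 : ℂ) • (ψ x - (x.trace / d) • (1 : Mat d)))
    (sum_trace_smul_hermUnit a)
  have hlin : ∀ x : Mat d, ψ x - (x.trace / d) • (1 : Mat d) = (ψ.toLinearMap -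
      ((Matrix.traceLinearMap (Fin d) ℂ ℂ).smulRight ((1 / d : ℂ) • (1 : Mat d)))) x := by
    intro x
    simp [smul_smul, div_eq_mul_inv]
  simp only [Finset.sum_add_distrib, ← Finset.smul_sum]
  simp only [hlin] at hf ⊢
  simp only [map_sum, map_smul] at hf
  rw [hf]
  simp only [← hlin, Finset.sum_const, Finset.card_univ, Fintype.card_fin, one_mul]
  match_scalars <;> field_simp
  ring

/-! ### Recurrence and measurability -/

/-- Almost every orbit of an ergodic map visits a set of positive measure infinitely often. -/
theorem Ergodic.ae_frequently_mem {Ω : Type*} [MeasurableSpace Ω] {μ : Measure Ω}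
    [IsProbabilityMeasure μ] {T : Ω → Ω} (hT : Ergodic T μ) {A : Set Ω} (hA : MeasurableSet A)
    (hA₀ : μ A ≠ 0) : ∀ᵐ ω ∂μ, ∃ᶠ n in Filter.atTop, T^[n] ω ∈ A := by
  let B : Set Ω := {ω | ∃ᶠ n in Filter.atTop, T^[n] ω ∈ A}
  have hB : MeasurableSet B := by
    have h : B = Filter.limsup (fun n => T^[n] ⁻¹' A) Filter.atTop := by
      ext ω
      simp [B, Filter.limsup_eq_iInf_iSup_of_nat, Filter.frequently_atTop]
    rw [h]
    exact MeasurableSet.measurableSet_limsup fun n => hT.measurable.iterate n hA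
  have hinv : T ⁻¹' B = B := by
    ext ω
    simp only [B, Set.mem_preimage, Set.mem_ofPred_eq, ← Function.iterate_succ_apply]
    conv_rhs => rw [← Filter.map_add_atTop_eq_nat 1, Filter.frequently_map]
  -- By invariance B is null or conull; Poincaré recurrence on A excludes null.
  rcases hT.toPreErgodic.ae_mem_or_ae_notMem hB hinv with h | h
  · exact h
  · have h' := hT.toMeasurePreserving.conservative.frequently_ae_mem_and_frequently_image_mem
      hA.nullMeasurableSet hA₀
    exact absurd (h.mono fun ω hω (hω' : ω ∈ A ∧ _) => hω hω'.2) h'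

theorem Matrix.isClosed_setOf_posSemidef {n : Type*} [Fintype n] :
    IsClosed {M : Matrix n n ℂ | M.PosSemidef} := by
  simp only [Matrix.posSemidef_iff_dotProduct_mulVec, Set.ofPred_and, Set.ofPred_forall,
    Matrix.IsHermitian]
  refine (isClosed_eq (by fun_prop) continuous_id).inter (isClosed_iInter fun v => ?_)
  exact isClosed_le continuous_const
    (continuous_const.dotProduct (continuous_id.matrix_mulVec continuous_const))

theorem Superop.apply_eq_sum {d : ℕ} (ψ : Superop d) (a : Mat d) :
    ψ a = ∑ k, ∑ l, a k l • ψ (Matrix.single k l 1) := by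
  conv_lhs => rw [Matrix.matrix_eq_sum_single a]
  simp only [map_sum]
  refine Finset.sum_congr rfl fun k _ => Finset.sum_congr rfl fun l _ => ?_
  rw [← map_smul, Matrix.smul_single, smul_eq_mul, mul_one]

section Cocycle

variable {Ω : Type*} {d : ℕ}

theorem cocycle_isBCP (T : Ω → Ω) (φ : Ω → bcp d) (n : ℕ) (ω : Ω) :
    (cocycle T φ n ω).IsBCP := by
  induction n with
  | zero => exact Superop.isBCP_id d
  | succ n ih => exact (φ (T^[n] ω)).2.comp ih

theorem cocycle_add (T : Ω → Ω) (φ : Ω → bcp d) (m n : ℕ) (ω : Ω) :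
    cocycle T φ (n + m) ω = (cocycle T φ n (T^[m] ω)).comp (cocycle T φ m ω) := by
  induction n with
  | zero => rw [Nat.zero_add]; rfl
  | succ n ih =>
    rw [Nat.succ_add, cocycle, ih, cocycle, ContinuousLinearMap.comp_assoc,
      ← Function.iterate_add_apply]

variable [MeasurableSpace Ω]

theorem measurable_cocycle_apply {T : Ω → Ω} (hT : Measurable T) {φ : Ω → bcp d}
    (hφ : Measurable φ) (n : ℕ) (a : Mat d) (i j : Fin d) :
    Measurable fun ω => cocycle T φ n ω a i j := by
  have hev : ∀ (a : Mat d) (i j : Fin d), Measurable fun ψ : Superop d => ψ a i j := fun a i j =>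
    ((continuous_eval_const a).matrix_elem i j).measurable
  induction n generalizing a i j with
  | zero => exact measurable_const
  | succ n ih =>
    have h : (fun ω => cocycle T φ (n + 1) ω a i j) = fun ω => ∑ k, ∑ l,
        cocycle T φ n ω a k l * (φ (T^[n] ω) : Superop d) (Matrix.single k l 1) i j := by
      funext ω
      rw [cocycle, ContinuousLinearMap.comp_apply, Superop.apply_eq_sum]
      simp [Matrix.sum_apply]
    rw [h]
    refine Finset.measurable_sum _ fun k _ => Finset.measurable_sum _ fun l _ => (ih a k l).mul ?_
    exact (hev _ i j).comp (measurable_subtype_coe.comp (hφ.comp (hT.iterate n)))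

/-- Being `r`-mixing is a closed condition on the matrix entries of the map, so the uncountable
quantifier over p is harmless. -/
theorem measurableSet_cocycle_isMixing {T : Ω → Ω} (hT : Measurable T) {φ : Ω → bcp d}
    (hφ : Measurable φ) (n : ℕ) (r : ℝ) :
    MeasurableSet {ω | (cocycle T φ n ω).IsMixing r} := by
  let G : Set (Fin d → Fin d → Fin d → Fin d → ℂ) := {m | ∀ p : Mat d, p.PosSemidef →
    ((∑ k, ∑ l, p k l • Matrix.of (m k l)) -
      ((((1 - r) / d : ℝ) : ℂ) * p.trace) • (1 : Mat d)).PosSemidef}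
  have hG : IsClosed G := by
    simp only [G, Set.ofPred_forall]
    refine isClosed_iInter fun p => isClosed_iInter fun _ =>
      Matrix.isClosed_setOf_posSemidef.preimage (Continuous.sub ?_ continuous_const)
    refine continuous_finsetSum _ fun k _ => continuous_finsetSum _ fun l _ => ?_
    exact Continuous.const_smul
      (show Continuous fun m : Fin d → Fin d → Fin d → Fin d → ℂ => m k l by fun_prop) (p k l)
  have hm : Measurable fun ω k l i j => cocycle T φ n ω (Matrix.single k l 1) i j :=
    measurable_pi_lambda _ fun k => measurable_pi_lambda _ fun l => measurable_pi_lambda _ fun i =>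
      measurable_pi_lambda _ fun j => measurable_cocycle_apply hT hφ n _ i j
  have : BorelSpace (Fin d → Fin d → ℂ) := inferInstance
  have : BorelSpace (Fin d → Fin d → Fin d → ℂ) := Pi.borelSpace
  have : BorelSpace (Fin d → Fin d → Fin d → Fin d → ℂ) := Pi.borelSpace
  convert hm hG.measurableSet using 1
  ext ω
  simp only [Superop.IsMixing, G, Set.mem_preimage, Set.mem_ofPred_eq]
  refine forall₂_congr fun p _ => ?_
  rw [Superop.apply_eq_sum (cocycle T φ n ω) p]
  rfl

/-- Along almost every orbit, the mixing defect of the cocycle is eventually below every power of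
some `r < 1`. -/
theorem exists_ae_eventually_isMixing_pow [NeZero d] (μ : Measure Ω) [IsProbabilityMeasure μ]
    {T : Ω → Ω} (hT : Ergodic T μ) {φ : Ω → bcp d} (hφ : Measurable φ)
    (hESP : EventuallyStrictlyPositive μ T φ) :
    ∃ r : ℝ, 0 ≤ r ∧ r < 1 ∧ ∀ᵐ ω ∂μ, ∀ k : ℕ, ∃ N : ℕ, ∀ n ≥ N,
      (cocycle T φ n ω).IsMixing (r ^ k) := by
  have h₁ : ∀ᵐ ω ∂μ, ∃ n q : ℕ, (cocycle T φ n ω).IsMixing (1 - 1 / ((q : ℝ) + 1)) := by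
    filter_upwards [hESP] with ω ⟨N, hN⟩
    obtain ⟨r, hr, h⟩ := (hN N le_rfl).exists_isMixing (cocycle_isBCP T φ N ω)
    obtain ⟨q, hq⟩ := exists_nat_one_div_lt (sub_pos.2 hr)
    exact ⟨N, q, h.mono (by linarith)⟩
  -- Defects 1 - 1/(q + 1) make the family countable, so one of the sets has positive measure.
  obtain ⟨n₀, q, hA₀⟩ : ∃ n q : ℕ,
      μ {ω | (cocycle T φ n ω).IsMixing (1 - 1 / ((q : ℝ) + 1))} ≠ 0 := by
    by_contra! h
    have h₂ : ∀ᵐ ω ∂μ, ∀ n q : ℕ, ¬ (cocycle T φ n ω).IsMixing (1 - 1 / ((q : ℝ) + 1)) :=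
      ae_all_iff.2 fun n => ae_all_iff.2 fun q => by
        rw [ae_iff]
        simpa using h n q
    obtain ⟨ω, ⟨n, q, h₃⟩, h₄⟩ := (h₁.and h₂).exists
    exact h₄ n q h₃
  set r : ℝ := 1 - 1 / ((q : ℝ) + 1) with hr
  have hq : 0 < 1 / ((q : ℝ) + 1) := Nat.one_div_pos_of_nat
  have hq' : 1 / ((q : ℝ) + 1) ≤ 1 := by
    rw [div_le_one (by positivity)]
    linarith [(Nat.cast_nonneg q : (0 : ℝ) ≤ q)]
  refine ⟨r, by linarith, by linarith, ?_⟩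
  filter_upwards [hT.ae_frequently_mem (measurableSet_cocycle_isMixing hT.measurable hφ n₀ r) hA₀]
    with ω hω k
  induction k with
  | zero => exact ⟨0, fun n _ => by simpa using (cocycle_isBCP T φ n ω).isMixing_one⟩
  | succ k ih =>
    obtain ⟨N, hN⟩ := ih
    obtain ⟨m, hm, hmA⟩ := Filter.frequently_atTop.1 hω N
    -- A good block of length n₀ starting at a time m ≥ N gains one factor r; the remaining l steps
    -- have defect 1.
    refine ⟨n₀ + m, fun n hn => ?_⟩
    obtain ⟨l, rfl⟩ := Nat.exists_eq_add_of_le' hn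
    rw [cocycle_add, cocycle_add T φ m n₀]
    have h := (Superop.IsMixing.comp hmA (hN m hm) (cocycle_isBCP T φ n₀ _)
      (cocycle_isBCP T φ m ω))
    have h' := (cocycle_isBCP T φ l (T^[n₀ + m] ω)).isMixing_one.comp h
      (cocycle_isBCP T φ l _) ((cocycle_isBCP T φ n₀ _).comp (cocycle_isBCP T φ m ω))
    rwa [one_mul, ← pow_succ'] at h'

end Cocycle

/-! ### Conclusion -/

theorem Superop.isEB_of_dim_zero (ψ : Superop 0) : ψ.IsEB := fun k ρ _ => by
  rw [Subsingleton.elim (ψ.ampliation k ρ) 0]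
  exact zero_mem _

theorem ae_eventually_isEB {Ω : Type*} [MeasurableSpace Ω] (μ : Measure Ω) [IsProbabilityMeasure μ]
    {T : Ω → Ω} (hT : Ergodic T μ) {d : ℕ} {φ : Ω → bcp d} (hφ : Measurable φ)
    (hESP : EventuallyStrictlyPositive μ T φ) :
    ∀ᵐ ω ∂μ, ∃ N : ℕ, ∀ n ≥ N, (cocycle T φ n ω).IsEB := by
  rcases d.eq_zero_or_pos with rfl | hd
  · exact .of_forall fun ω => ⟨0, fun n _ => Superop.isEB_of_dim_zero _⟩
  have : NeZero d := ⟨hd.ne'⟩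
  obtain ⟨r, hr₀, hr₁, h⟩ := exists_ae_eventually_isMixing_pow μ hT hφ hESP
  have hd' : (0 : ℝ) < 4 * d ^ 3 := by positivity
  obtain ⟨k, hk⟩ := exists_pow_lt_of_lt_one (inv_pos.2 hd') hr₁
  filter_upwards [h] with ω hω
  obtain ⟨N, hN⟩ := hω k
  refine ⟨N, fun n hn => (hN n hn).isEB (pow_nonneg hr₀ k) (cocycle_isBCP T φ n ω).unital ?_⟩
  calc 4 * (d : ℝ) ^ 3 * r ^ k ≤ 4 * (d : ℝ) ^ 3 * (4 * (d : ℝ) ^ 3)⁻¹ := by gcongr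
    _ = 1 := mul_inv_cancel₀ hd'.ne'

theorem mainTheorem8 {Ω : Type*} [MeasurableSpace Ω] (μ : Measure Ω) [IsProbabilityMeasure μ]
    (T : Ω ≃ᵐ Ω) (hT : Ergodic T μ) (d : ℕ) (φ : Ω → bcp d) (hφ : Measurable φ)
    (hESP : EventuallyStrictlyPositive μ T φ) :
    EventuallyEB μ T φ ∧
      ∀ᵐ ω ∂μ, ∃ N : ℕ, ∀ n ≥ N, (cocycle T φ n ω).IsEB := by
  have h := ae_eventually_isEB μ hT hφ hESP
  refine ⟨?_, h⟩
  filter_upwards [h] with ω ⟨N, hN⟩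
  exact ⟨max N 1, le_max_right _ _, hN _ (le_max_left _ _)⟩
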